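/- **Setting.** Let $M$ be a smooth (Hausdorff, second countable) manifold of dimension $m$, $U\subset\mathbb R^k$ open with $k\le m$, $X\colon M\times U\to TM$ a smooth vector field along the projection $M\times U\to M$, $F\colon M\times U\to\mathbb R$ a smooth cost function and $[a,b]$ a fixed time interval, $a<b$. On $T^*M\times U$ let $\Omega$ be the pull-back of the canonical 2-form $\sum dx^i\wedge dp_i$ of $T^*M$, and for $p_0\in\{-1,0\}$ let $H^{[p_0]}(\lambda,u)=\langle\lambda,X(x,u)\rangle+p_0F(x,u)$ for $\lambda\in T_x^*M$. Curves are continuous and piecewise differentiable (differentiable except at finitely many times), and differential equations along curves are required except at finitely many times. **Extremals.** A curve $(\gamma,u)\colon[a,b]\to M\times U$ is a *normal* extremal (resp. an *abnormal* extremal) if, with $p_0=-1$ (resp. $p_0=0$), there is a curve $\lambda\colon[a,b]\to T^*M$ along $\gamma$ such that $i_{(\dot\lambda(t),\dot u(t))}\Omega=dH^{[p_0]}(\lambda(t),u(t))$, the function $t\mapsto H^{[p_0]}(\lambda(t),u(t))$ is constant on $[a,b]$, and $(p_0,\lambda(t))\ne0$ for every $t\in[a,b]$. **Constraint algorithm.**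 For $\beta\in T^*M\times U$ let $X^{N_0}(\beta)$ be the set of all $v\in T_\beta(T^*M\times U)$ with $i_v\Omega=d_\beta H^{[p_0]}$, and $N_0=\{\beta : X^{N_0}(\beta)\neq\emptyset\}$. Inductively, $$N_{i+1}=\{\beta\in N_i : X^{N_i}(\beta)\cap T_\beta N_i\ne\emptyset\},\qquad X^{N_{i+1}}(\beta)=X^{N_i}(\beta)\cap T_\beta N_i ,$$ where $T_\beta N$ is the set of velocities at $\beta$ of smooth curves in $N$ (the tangent space if $N$ is a submanifold). Let $X^{N_f}=\bigcap_iX^{N_i}$, and let the final constraint set $N_f^{[p_0]}$ be $\bigcap_iN_i$, from which, if $p_0=0$, the points with zero covector are deleted. We say that a curve $(\lambda,u)$ on $[a,b]$ *is in* $N_f^{[p_0]}$ if $(\lambda(t),u(t))\in N_f^{[p_0]}$ for all $t\in[a,b]$ and $(\lambda,u)$ is an integral curve of the final solution, that is, $(\dot\lambda(t),\dot u(t))\in X^{N_f}(\lambda(t),u(t))$ except at finitely many $t$. **Proposition.** Let $(\gamma,u)$ be an abnormal extremal. If there is a curve $\lambda$ in $T^*M$ along $\gamma$ such that $(\lambda,u)$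 is in $N_f^{[-1]}$, then $(\gamma,u)$ is also a normal extremal. Let $(\gamma,u)$ be a normal extremal. If there is a curve $\lambda$ in $T^*M$ along $\gamma$ such that $(\lambda,u)$ is in $N_f^{[0]}$, then $(\gamma,u)$ is also an abnormal extremal. -/

import Mathlib

open scoped Manifold ContDiff Topology

noncomputable section

namespace PresymplecticOCP

/-- The cotangent bundle `T*M` of an `m`-dimensional manifold `M`: its points are pairs
`⟨x, p⟩` with `p` a continuous linear form on `T_x M`. -/
abbrev CotangentBundle (m : ℕ) (M : Type*) [TopologicalSpace M]
    [ChartedSpace (EuclideanSpace ℝ (Fin m)) M] [IsManifold (𝓡 m) ∞ M] : Type _ :=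
  Bundle.TotalSpace (EuclideanSpace ℝ (Fin m) →L[ℝ] ℝ)
    (fun x : M => TangentSpace (𝓡 m) x →L[ℝ] Bundle.Trivial M ℝ x)

/-- The model with corners of `T*M`. -/
abbrev cotangentModel (m : ℕ) :=
  (𝓡 m).prod 𝓘(ℝ, EuclideanSpace ℝ (Fin m) →L[ℝ] ℝ)

/-- The canonical 2-form `∑ dxⁱ ∧ dpᵢ` of `T*M` at the point `α`. The preferred chart of `T*M`
at `α` is the system of natural coordinates `(x, p)` induced by the preferred chart of `M` at
the base point of `α`; it takes values in `ℝᵐ × (ℝᵐ)*`. -/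
def canonicalForm {m : ℕ} {M : Type*} [TopologicalSpace M]
    [ChartedSpace (EuclideanSpace ℝ (Fin m)) M] [IsManifold (𝓡 m) ∞ M]
    (α : CotangentBundle m M) (v w : TangentSpace (cotangentModel m) α) : ℝ :=
  let D : TangentSpace (cotangentModel m) α →L[ℝ]
      EuclideanSpace ℝ (Fin m) × (EuclideanSpace ℝ (Fin m) →L[ℝ] ℝ) :=
    mfderiv (cotangentModel m)
      𝓘(ℝ, EuclideanSpace ℝ (Fin m) × (EuclideanSpace ℝ (Fin m) →L[ℝ] ℝ))
      (extChartAt (cotangentModel m) α) α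
  (D w).2 (D v).1 - (D v).2 (D w).1

end PresymplecticOCP

/-- The data of a fixed-time optimal control problem on the manifold `M` with controls in an
open subset of `ℝᵏ`: control set, control system (a smooth vector field along the projection
`M × U → M`), smooth cost function, and time interval `[a, b]`. -/
structure OptimalControlProblem (m k : ℕ) (M : Type*) [TopologicalSpace M]
    [ChartedSpace (EuclideanSpace ℝ (Fin m)) M] [IsManifold (𝓡 m) ∞ M] where
  /-- the open control set -/
  U : TopologicalSpace.Opens (EuclideanSpace ℝ (Fin k))
  /-- the control system -/
  X : (q : M × U) → TangentSpace (𝓡 m) q.1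
  smooth_X : ContMDiff ((𝓡 m).prod (𝓡 k)) (𝓡 m).tangent ∞
    (fun q : M × U => (⟨q.1, X q⟩ : TangentBundle (𝓡 m) M))
  /-- the cost function -/
  F : M × U → ℝ
  smooth_F : ContMDiff ((𝓡 m).prod (𝓡 k)) 𝓘(ℝ, ℝ) ∞ F
  /-- the initial time -/
  a : ℝ
  /-- the final time -/
  b : ℝ
  a_lt_b : a < b

namespace OptimalControlProblem

open PresymplecticOCP

variable {m k : ℕ} {M : Type*} [TopologicalSpace M]
  [ChartedSpace (EuclideanSpace ℝ (Fin m)) M] [IsManifold (𝓡 m) ∞ M]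
  (P : OptimalControlProblem m k M)

/-- The presymplectic manifold `T*M × U`. -/
abbrev Phase : Type _ := CotangentBundle m M × P.U

/-- The model with corners of `T*M × U`. -/
abbrev phaseModel (_P : OptimalControlProblem m k M) := (cotangentModel m).prod (𝓡 k)

/-- The tangent space of `T*M × U` at `β`. -/
abbrev TangentAt (β : P.Phase) : Type := TangentSpace P.phaseModel β

/-- The presymplectic form `Ω`: the pull-back of the canonical 2-form of `T*M` through the
projection `T*M × U → T*M`. -/
def Ω (β : P.Phase) (v w : P.TangentAt β) : ℝ :=
  canonicalForm β.1
    (mfderiv P.phaseModel (cotangentModel m) (Prod.fst : P.Phase → CotangentBundle m M) β v)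
    (mfderiv P.phaseModel (cotangentModel m) (Prod.fst : P.Phase → CotangentBundle m M) β w)

/-- Pontryagin's Hamiltonian `H(p, u) = ⟨p, X(x, u)⟩ + p₀ F(x, u)`, for `p ∈ T*ₓM`. -/
def H (p₀ : ℝ) (β : P.Phase) : ℝ :=
  (β.1.2 (P.X (β.1.1, β.2)) : ℝ) + p₀ * P.F (β.1.1, β.2)

/-- The solutions `v ∈ T_β(T*M × U)` of the presymplectic equation `i_v Ω = dH` at `β`. -/
def hamiltonSolutions (p₀ : ℝ) (β : P.Phase) : Set (P.TangentAt β) :=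
  {v | ∀ w : P.TangentAt β, P.Ω β v w = mfderiv P.phaseModel 𝓘(ℝ, ℝ) (P.H p₀) β w}

/-- The vector `v` is the velocity at time `t` of the curve `c` defined on `[a, b]`
(one-sided at the end points). -/
def HasVelocityAt (c : ℝ → P.Phase) (t : ℝ) (v : P.TangentAt (c t)) : Prop :=
  HasMFDerivWithinAt 𝓘(ℝ, ℝ) P.phaseModel c (Set.Icc P.a P.b) t ((1 : ℝ →L[ℝ] ℝ).smulRight v)

/-- The curve `c : [a, b] → T*M × U` is continuous and piecewise differentiable, and, except at
finitely many times, its velocity at `t` is one of the vectors of `V (c t)`. -/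
def IsIntegralCurveOf (V : (β : P.Phase) → Set (P.TangentAt β)) (c : ℝ → P.Phase) : Prop :=
  ContinuousOn c (Set.Icc P.a P.b) ∧
    ∃ s : Set ℝ, s.Finite ∧
      ∀ t ∈ Set.Icc P.a P.b \ s, ∃ v ∈ V (c t), P.HasVelocityAt c t v

/-- The curve `l` in `T*M` is along the curve `γ` in `M`. -/
def IsAlong (l : ℝ → CotangentBundle m M) (γ : ℝ → M) : Prop :=
  ∀ t ∈ Set.Icc P.a P.b, (l t).1 = γ t

/-- `(l, u)` and `p₀` satisfy the necessary conditions of Pontryagin's Maximum Principle in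
presymplectic form: `(l, u)` solves `i_{(l', u')} Ω = dH`, the Hamiltonian is constant along
`(l, u)`, and `(p₀, l(t))` vanishes nowhere. -/
structure IsBiextremal (p₀ : ℝ) (l : ℝ → CotangentBundle m M) (u : ℝ → P.U) : Prop where
  integralCurve : P.IsIntegralCurveOf (P.hamiltonSolutions p₀) (fun t => (l t, u t))
  constant : ∃ h : ℝ, ∀ t ∈ Set.Icc P.a P.b, P.H p₀ (l t, u t) = h
  nontrivial : ∀ t ∈ Set.Icc P.a P.b, ¬ (p₀ = 0 ∧ (l t).2 = 0)

/-- `(γ, u)` is a normal extremal: it has a biextremal lift with `p₀ = -1`. -/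
def IsNormalExtremal (γ : ℝ → M) (u : ℝ → P.U) : Prop :=
  ∃ l : ℝ → CotangentBundle m M, P.IsAlong l γ ∧ P.IsBiextremal (-1) l u

/-- `(γ, u)` is an abnormal extremal: it has a biextremal lift with `p₀ = 0`. -/
def IsAbnormalExtremal (γ : ℝ → M) (u : ℝ → P.U) : Prop :=
  ∃ l : ℝ → CotangentBundle m M, P.IsAlong l γ ∧ P.IsBiextremal 0 l u

/-- The vectors tangent at `β` to a subset `N` of `T*M × U`: the velocities at `β` of the smooth
curves that stay in `N`. For a submanifold `N` and `β ∈ N` this is the tangent space `T_β N`. -/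
def tangentTo (N : Set P.Phase) (β : P.Phase) : Set (P.TangentAt β) :=
  {v | ∃ c : ℝ → P.Phase,
    ContMDiffAt 𝓘(ℝ, ℝ) P.phaseModel ∞ c 0 ∧ (∀ᶠ t in 𝓝 (0 : ℝ), c t ∈ N) ∧
      (⟨c 0, mfderiv 𝓘(ℝ, ℝ) P.phaseModel c 0 (1 : ℝ)⟩ : TangentBundle P.phaseModel P.Phase)
        = ⟨β, v⟩}

/-- The constraint algorithm for the Hamiltonian with constant `p₀`. Stage `i` is the pair of the
constraint set `N_i` and of the set `X^{N_i}` of the solutions, given pointwise: `X^{N_i}(β)` is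
the set of the values at `β ∈ N_i` that a solution is still allowed to take.
* `N_0` is the set of the points at which the presymplectic equation has a solution, and
  `X^{N_0}(β)` consists of all its solutions at `β`;
* `N_{i+1}` is the set of the points of `N_i` at which some element of `X^{N_i}` is tangent to
  `N_i`, and `X^{N_{i+1}}` consists of the elements of `X^{N_i}` that are tangent to `N_i`. -/
def stage (p₀ : ℝ) : ℕ → Set P.Phase × ((β : P.Phase) → Set (P.TangentAt β))
  | 0 => ({β | (P.hamiltonSolutions p₀ β).Nonempty}, P.hamiltonSolutions p₀)
  | i + 1 =>
    ({β | β ∈ (stage p₀ i).1 ∧ ∃ v ∈ (stage p₀ i).2 β, v ∈ P.tangentTo (stage p₀ i).1 β},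
      fun β => {v | v ∈ (stage p₀ i).2 β ∧ v ∈ P.tangentTo (stage p₀ i).1 β})

/-- The final constraint set `N_f`: the intersection of all the `N_i`, from which the zero
covectors are deleted if `p₀ = 0`. -/
def finalConstraint (p₀ : ℝ) : Set P.Phase :=
  {β | (∀ i, β ∈ (P.stage p₀ i).1) ∧ ¬ (p₀ = 0 ∧ β.1.2 = 0)}

/-- The final solutions `X^{N_f}`: the intersection of all the `X^{N_i}`. -/
def finalSolutions (p₀ : ℝ) (β : P.Phase) : Set (P.TangentAt β) :=
  {v | ∀ i, v ∈ (P.stage p₀ i).2 β}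

/-- `(l, u)` is a curve of the final pair `(N_f, X^{N_f})`: it stays in `N_f` and is an integral
curve of `X^{N_f}`. -/
def IsInFinalConstraint (p₀ : ℝ) (l : ℝ → CotangentBundle m M) (u : ℝ → P.U) : Prop :=
  (∀ t ∈ Set.Icc P.a P.b, (l t, u t) ∈ P.finalConstraint p₀) ∧
    P.IsIntegralCurveOf (P.finalSolutions p₀) (fun t => (l t, u t))

end OptimalControlProblem

end

/-! A curve of the final pair for a given `p₀` is already a biextremal for that `p₀`, so its
projection is an extremal of the corresponding kind. Since `X^{N_f} ⊆ X^{N_0}`, it solves `i_v Ω =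
dH`. Nontriviality is built into `N_f`: zero covectors are deleted when `p₀ = 0`, and `p₀ = -1` is
nonzero. Constancy of `H` is energy conservation, `dH(v) = Ω(v, v) = 0`, at all but finitely many
times; continuity of the curve excludes jumps at the exceptional ones
(`IsIntegralCurveOf.exists_H_eq`). -/

/-- A real function that is continuous on `[a, b]` and has derivative zero inside `[a, b]` except
at countably many points is constant on `[a, b]`. -/
theorem constant_of_hasDerivAt_zero_off_countable {f : ℝ → ℝ} {a b : ℝ} {s : Set ℝ}
    (hs : s.Countable) (hf : ContinuousOn f (Set.Icc a b))
    (hd : ∀ t ∈ Set.Ioo a b \ s, HasDerivAt f 0 t) : ∀ t ∈ Set.Icc a b, f t = f a := by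
  intro t ht
  -- The fundamental theorem of calculus on `[a, t]`, which tolerates a countable exceptional set:
  -- `f t - f a` is the integral of `0`.
  have h := MeasureTheory.integral_eq_of_hasDerivAt_off_countable_of_le f (fun _ => 0) ht.1 hs
    (hf.mono (Set.Icc_subset_Icc_right ht.2))
    (fun x hx => hd x ⟨⟨hx.1.1, hx.1.2.trans_le ht.2⟩, hx.2⟩) intervalIntegrable_const
  rw [intervalIntegral.integral_zero] at h
  linarith

namespace OptimalControlProblem

open PresymplecticOCP

variable {m k : ℕ} {M : Type*} [TopologicalSpace M]
  [ChartedSpace (EuclideanSpace ℝ (Fin m)) M] [IsManifold (𝓡 m) ∞ M]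
  (P : OptimalControlProblem m k M)

theorem Ω_self (β : P.Phase) (v : P.TangentAt β) : P.Ω β v v = 0 := by
  simp only [Ω, canonicalForm, sub_self]

/-- Evaluating a smooth covector field on a smooth vector field, both along `β ↦ β.1.1`, gives a
smooth function. This supplies both the continuity and the chain rule needed to differentiate `H`
along curves. -/
theorem contMDiff_H (p₀ : ℝ) : ContMDiff P.phaseModel 𝓘(ℝ, ℝ) ∞ (P.H p₀) := by
  have hbase : ContMDiff P.phaseModel ((𝓡 m).prod (𝓡 k)) ∞
      (fun β : P.Phase => ((β.1.1, β.2) : M × P.U)) :=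
    ((Bundle.contMDiff_proj (fun x : M => TangentSpace (𝓡 m) x →L[ℝ] Bundle.Trivial M ℝ x)).comp
      contMDiff_fst).prodMk contMDiff_snd
  have hpair : ContMDiff P.phaseModel 𝓘(ℝ, ℝ) ∞
      (fun β : P.Phase => (β.1.2 (P.X (β.1.1, β.2)) : ℝ)) := by
    intro β
    have hcov : ContMDiffAt P.phaseModel (cotangentModel m) ∞
        (fun β : P.Phase => Bundle.TotalSpace.mk' (EuclideanSpace ℝ (Fin m) →L[ℝ] ℝ)
          (E := fun x : M => TangentSpace (𝓡 m) x →L[ℝ] Bundle.Trivial M ℝ x)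
          β.1.1 β.1.2) β := contMDiffAt_fst
    have hvec : ContMDiffAt P.phaseModel (𝓡 m).tangent ∞
        (fun β : P.Phase => Bundle.TotalSpace.mk' (EuclideanSpace ℝ (Fin m))
          (E := fun x : M => TangentSpace (𝓡 m) x) β.1.1 (P.X (β.1.1, β.2))) β :=
      (P.smooth_X.comp hbase) β
    have h := ContMDiffAt.clm_bundle_apply hcov hvec
    -- The pairing is obtained as a map into the trivial line bundle; its fibre coordinate is the
    -- real-valued function.
    simp only [Bundle.contMDiffAt_totalSpace] at h
    exact h.2
  exact hpair.add (contMDiff_const.mul (P.smooth_F.comp hbase))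

/-- The Hamiltonian is constant along the integral curves of the presymplectic equation. -/
theorem IsIntegralCurveOf.exists_H_eq {P : OptimalControlProblem m k M} {p₀ : ℝ}
    {c : ℝ → P.Phase} (hc : P.IsIntegralCurveOf (P.hamiltonSolutions p₀) c) :
    ∃ h : ℝ, ∀ t ∈ Set.Icc P.a P.b, P.H p₀ (c t) = h := by
  obtain ⟨hcont, s, hs, hvel⟩ := hc
  refine ⟨P.H p₀ (c P.a), constant_of_hasDerivAt_zero_off_countable
    (f := fun t => P.H p₀ (c t)) hs.countable
    ((P.contMDiff_H p₀).continuous.comp_continuousOn hcont) fun t ht => ?_⟩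
  obtain ⟨v, hv, hcv⟩ := hvel t ⟨Set.Ioo_subset_Icc_self ht.1, ht.2⟩
  have hH : HasMFDerivAt P.phaseModel 𝓘(ℝ, ℝ) (P.H p₀) (c t)
      (mfderiv P.phaseModel 𝓘(ℝ, ℝ) (P.H p₀) (c t)) :=
    (((P.contMDiff_H p₀) (c t)).mdifferentiableAt (by simp)).hasMFDerivAt
  -- At an interior time `[a, b]` is a neighbourhood of `t`, so the derivative within it is a full
  -- derivative.
  have hcomp := (hH.comp_hasMFDerivWithinAt t hcv).hasMFDerivAt (Icc_mem_nhds ht.1.1 ht.1.2)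
  have hzero : mfderiv P.phaseModel 𝓘(ℝ, ℝ) (P.H p₀) (c t) v = 0 :=
    (hv v).symm.trans (P.Ω_self (c t) v)
  -- Stated for an arbitrary `L` so that the manifold derivative, a map between tangent spaces of
  -- `ℝ`, can be read as a map `ℝ →L[ℝ] ℝ`.
  have hderiv (L : ℝ →L[ℝ] ℝ) (hL : HasFDerivAt (fun t => P.H p₀ (c t)) L t) (hL1 : L 1 = 0) :
      HasDerivAt (fun t => P.H p₀ (c t)) 0 t := hL1 ▸ hL.hasDerivAt
  refine hderiv _ (hasMFDerivAt_iff_hasFDerivAt.mp hcomp) ?_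
  change mfderiv P.phaseModel 𝓘(ℝ, ℝ) (P.H p₀) (c t) ((1 : ℝ) • v) = 0
  rw [one_smul, hzero]

theorem IsIntegralCurveOf.mono {P : OptimalControlProblem m k M}
    {V W : (β : P.Phase) → Set (P.TangentAt β)} {c : ℝ → P.Phase}
    (hc : P.IsIntegralCurveOf V c) (hVW : ∀ β, V β ⊆ W β) : P.IsIntegralCurveOf W c := by
  obtain ⟨hcont, s, hs, hvel⟩ := hc
  refine ⟨hcont, s, hs, fun t ht => ?_⟩
  obtain ⟨v, hv, hcv⟩ := hvel t ht
  exact ⟨v, hVW _ hv, hcv⟩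

/-- A curve of the final pair of the constraint algorithm is a biextremal. -/
theorem IsInFinalConstraint.isBiextremal {P : OptimalControlProblem m k M} {p₀ : ℝ}
    {l : ℝ → CotangentBundle m M} {u : ℝ → P.U} (h : P.IsInFinalConstraint p₀ l u) :
    P.IsBiextremal p₀ l u := by
  -- Stage `0` of the algorithm is `hamiltonSolutions` by definition, hence the index `0`.
  have hc := h.2.mono (W := P.hamiltonSolutions p₀) fun _ _ hv => hv 0
  exact ⟨hc, hc.exists_H_eq, fun t ht => (h.1 t ht).2⟩

end OptimalControlProblem

theorem propositionc2 {m k : ℕ} (hkm : k ≤ m) {M : Type*} [TopologicalSpace M] [T2Space M]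
    [SecondCountableTopology M] [ChartedSpace (EuclideanSpace ℝ (Fin m)) M]
    [IsManifold (𝓡 m) ∞ M] (P : OptimalControlProblem m k M) (γ : ℝ → M) (u : ℝ → P.U) :
    (P.IsAbnormalExtremal γ u →
      (∃ l : ℝ → PresymplecticOCP.CotangentBundle m M,
        P.IsAlong l γ ∧ P.IsInFinalConstraint (-1) l u) →
      P.IsNormalExtremal γ u) ∧
    (P.IsNormalExtremal γ u →
      (∃ l : ℝ → PresymplecticOCP.CotangentBundle m M,
        P.IsAlong l γ ∧ P.IsInFinalConstraint 0 l u) →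
      P.IsAbnormalExtremal γ u) := by
  exact ⟨fun _ ⟨l, hl, h⟩ => ⟨l, hl, h.isBiextremal⟩, fun _ ⟨l, hl, h⟩ => ⟨l, hl, h.isBiextremal⟩⟩
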